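/- **Hamiltonian Weak Regularity Lemma.** Let $k\ge 1$ and $d=2^{r}$ be fixed. A $k$-local Hamiltonian on $n$ qudits of local dimension $d$ is $H=\sum_{e\in E}H_e\otimes \mathbb I_{V\setminus e}$, where $V=[n]$, $E$ is a set of $k$-element subsets of $V$, and each $H_e$ is a Hermitian operator on the qudits in $e$. Put $J_e=\|H_e\|_\infty$ (spectral norm) and $\|J\|_F=(\sum_{e\in E}J_e^2)^{1/2}$. A colour is a $k$-tuple $c=(c_1,\dots,c_k)$ of labels of the $d^2$ Pauli operators $\sigma_p\in\{\mathbb I,X,Y,Z\}^{\otimes r}$ on one qudit. For distinct sites $t=(t_1,\dots,t_k)$ let $\sigma^c_t$ be the operator acting as $\sigma_{c_j}$ on site $t_j$ for each $j$. The interaction array $M^c$ of colour $c$ has entries $M^c_t=d^{-k}\,\mathrm{Tr}[H_{e}\,\sigma^c_t]$ if $t$ is an ordering of an edge $e\in E$, and $0$ for all other $t\in[n]^k$. Thus $H=\frac1{k!}\sum_c\sum_{t\text{ distinct}}M^c_t\,\sigma^c_t\otimes\mathbb I_{V\setminus t}$. A cut array of weight $\alpha\in\mathbb R$ with sides $S_1,\dots,S_k\subseteq[n]$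 equals $\alpha$ on $S_1\times\cdots\times S_k$ and $0$ elsewhere. Given finitely many cut arrays $D^{c,1},\dots,D^{c,s_c}$ for each colour $c$, write $M^c=\sum_i D^{c,i}+W^c$ and set $$H_D=\frac1{k!}\sum_c\sum_{i\le s_c}\ \sum_{t\in[n]^k,\ t_a\ne t_b}D^{c,i}_t\;\sigma^c_t\otimes\mathbb I_{V\setminus t}.$$ For an array $W$ let $\|W\|_F$ be the Euclidean norm of its entries and $\|W\|_{\infty\to1}=\max\big|\sum_t W_t\prod_j x_{j,t_j}\big|$ over real vectors $x_1,\dots,x_k$ with $\|x_j\|_\infty\le1$. Then there are constants $A,B>0$, depending only on $k$ and $d$, such that the following holds for every $\varepsilon>0$, every $n$ and every $k$-local $H$ as above. 1. There are cut arrays such that, for every colour $c$, one has $\|W^c\|_{\infty\to1}\le\frac{\varepsilon}{A}\,n^{k/2}\|M^c\|_F$, the width satisfies $s_c\le B/\varepsilon^2$, the $k$ sides of each cut array are pairwise disjoint (so each cut array contributes a complete $k$-partite, for $k=2$ complete bipartite, sub-Hamiltonian to $H_D$), the weights satisfy $(\sum_i\alpha_{c,i}^2)^{1/2}\le B\|M^c\|_F/n^{k/2}$,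 and $\|W^c\|_F\le\|M^c\|_F$. 2. For every choice of cut arrays (with arbitrary sides) such that $\|W^c\|_{\infty\to1}\le\frac{\varepsilon}{A}\,n^{k/2}\|M^c\|_F$ for every colour $c$: - $|\mathrm{Tr}[(H-H_D)\rho]|\le\varepsilon\,n^{k/2}\|J\|_F$ for every product state $\rho=\bigotimes_u\rho_u$; - $\|H-H_D\|_\infty\le\varepsilon\,n^{k/2}\|J\|_F$, which for $k=2$ reads $\|H-H_D\|_\infty\le\varepsilon\,n\,\|J\|_F$; - if moreover $\|H_e\|_\infty\le1$ for all $e\in E$ and $m=|E|$, then both quantities are at most $\varepsilon\,n^{k/2}m^{1/2}$. -/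

import Mathlib

noncomputable section

/-- Basis labels of one qudit of local dimension `2 ^ r`, seen as `r` qubits. -/
abbrev Qudit (r : ℕ) : Type := Fin r → Fin 2

/-- Labels of the `4 ^ r` Pauli operators acting on one qudit of local dimension `2 ^ r`. -/
abbrev PauliLabel (r : ℕ) : Type := Fin r → Fin 4

/-- Basis labels of `n` qudits of local dimension `2 ^ r`. -/
abbrev Config (n r : ℕ) : Type := Fin n → Qudit r

/-- Order-`k` real arrays with index set `[n]` in each direction. -/
abbrev Tensor (n k : ℕ) : Type := (Fin k → Fin n) → ℝ

/-- The spectral norm (largest singular value) of a square complex matrix. -/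
def matrixSpectralNorm {ι : Type*} [Fintype ι] [DecidableEq ι] (A : Matrix ι ι ℂ) : ℝ :=
  ‖Matrix.toEuclideanCLM (𝕜 := ℂ) A‖

/-- The single-qubit Pauli matrices `I, X, Y, Z`. -/
def qubitPauli : Fin 4 → Matrix (Fin 2) (Fin 2) ℂ :=
  ![!![1, 0; 0, 1], !![0, 1; 1, 0], !![0, -Complex.I; Complex.I, 0], !![1, 0; 0, -1]]

/-- The Pauli operator `⊗ₐ σ_{p a}` on one qudit (`r` qubits). -/
def pauli {r : ℕ} (p : PauliLabel r) : Matrix (Qudit r) (Qudit r) ℂ :=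
  fun x y => ∏ a, qubitPauli (p a) (x a) (y a)

/-- The product operator `⊗ᵤ ρ u` on `n` qudits. -/
def tensorOp {n r : ℕ} (ρ : Fin n → Matrix (Qudit r) (Qudit r) ℂ) :
    Matrix (Config n r) (Config n r) ℂ :=
  fun x y => ∏ u, ρ u (x u) (y u)

open scoped ComplexOrder in
/-- Density matrices. -/
def IsDensity {ι : Type*} [Fintype ι] (ρ : Matrix ι ι ℂ) : Prop :=
  ρ.PosSemidef ∧ ρ.trace = 1

/-- The operator `A ⊗ I_{V ∖ e}` on `n` qudits, for `A` acting on the qudits in `e`. -/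
def embedOp {n r : ℕ} (e : Finset (Fin n)) (A : Matrix (e → Qudit r) (e → Qudit r) ℂ) :
    Matrix (Config n r) (Config n r) ℂ :=
  fun x y => if ∀ u, u ∉ e → x u = y u then A (fun u => x u) (fun u => y u) else 0

/-- The set of sites of a tuple. -/
def tupleSupp {n k : ℕ} (t : Fin k → Fin n) : Finset (Fin n) := Finset.univ.image t

/-- For a tuple `t` of distinct sites and a colour `c`, the operator on the qudits in `t` with the
Pauli operator labelled `c j` at the site `t j`, for every `j`. -/
def pauliLocal {n k r : ℕ} (c : Fin k → PauliLabel r) (t : Fin k → Fin n) :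
    Matrix (tupleSupp t → Qudit r) (tupleSupp t → Qudit r) ℂ :=
  fun x y => ∏ j, pauli (c j)
    (x ⟨t j, Finset.mem_image_of_mem t (Finset.mem_univ j)⟩)
    (y ⟨t j, Finset.mem_image_of_mem t (Finset.mem_univ j)⟩)

/-- A `k`-local Hamiltonian on `n` qudits of local dimension `2 ^ r`: a set of hyperedges, each with
`k` sites, and a Hermitian interaction on the qudits of each hyperedge. The value of `term` off
`edges` is never used. -/
structure LocalHamiltonian (n k r : ℕ) where
  edges : Finset (Finset (Fin n))
  card_edge : ∀ e ∈ edges, e.card = k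
  term : ∀ e : Finset (Fin n), Matrix (e → Qudit r) (e → Qudit r) ℂ
  isHermitian : ∀ e ∈ edges, (term e).IsHermitian

/-- The matrix `H = ∑ₑ Hₑ ⊗ I_{V ∖ e}`. -/
def LocalHamiltonian.toMatrix {n k r : ℕ} (H : LocalHamiltonian n k r) :
    Matrix (Config n r) (Config n r) ℂ :=
  ∑ e ∈ H.edges, embedOp e (H.term e)

/-- `‖J‖_F`, where `Jₑ = ‖Hₑ‖_∞` is the array of interaction strengths: `‖J‖_F ^ 2 = ∑ₑ Jₑ ^ 2`, each
hyperedge being counted once. -/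
def LocalHamiltonian.strengthNorm {n k r : ℕ} (H : LocalHamiltonian n k r) : ℝ :=
  Real.sqrt (∑ e ∈ H.edges, matrixSpectralNorm (H.term e) ^ 2)

/-- The interaction array of colour `c`: its entry at an ordering `t` of a hyperedge `e` is the
(real) coefficient `d ^ (-k) * Tr[Hₑ (⊗ⱼ σ_{c j} at t j)]` of the Pauli expansion of `Hₑ`; all other
entries are `0`. -/
def LocalHamiltonian.colorTensor {n k r : ℕ} (H : LocalHamiltonian n k r)
    (c : Fin k → PauliLabel r) : Tensor n k :=
  fun t => if tupleSupp t ∈ H.edges then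
    ((H.term (tupleSupp t) * pauliLocal c t).trace).re / ((2 : ℝ) ^ r) ^ k else 0

/-- The Frobenius norm of an array. -/
def frobNorm {n k : ℕ} (M : Tensor n k) : ℝ := Real.sqrt (∑ t, M t ^ 2)

/-- The norm `‖M‖_{∞ → 1} = max |∑ₜ M t ∏ⱼ x j (t j)|` over vectors `x j` with `‖x j‖_∞ ≤ 1`. -/
def inftyOneNorm {n k : ℕ} (M : Tensor n k) : ℝ :=
  sSup {y : ℝ | ∃ x : Fin k → Fin n → ℝ, (∀ j v, |x j v| ≤ 1) ∧
    y = |∑ t, M t * ∏ j, x j (t j)|}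

/-- A cut array `CUT(d, S₁, …, S_k)`. -/
structure CutArray (n k : ℕ) where
  weight : ℝ
  side : Fin k → Finset (Fin n)

/-- The array with entry `d` on `S₁ × ⋯ × S_k` and `0` elsewhere. -/
def CutArray.toTensor {n k : ℕ} (D : CutArray n k) : Tensor n k :=
  fun t => if ∀ j, t j ∈ D.side j then D.weight else 0

/-- A finite family of cut arrays; their number is the width. -/
structure CutFamily (n k : ℕ) where
  width : ℕ
  cut : Fin width → CutArray n k

/-- The sum of the cut arrays of a family. -/
def CutFamily.toTensor {n k : ℕ} (D : CutFamily n k) : Tensor n k :=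
  fun t => ∑ i, (D.cut i).toTensor t

/-- The coefficient length `(∑ᵢ dᵢ ^ 2) ^ (1 / 2)`. -/
def CutFamily.coeffLength {n k : ℕ} (D : CutFamily n k) : ℝ :=
  Real.sqrt (∑ i, (D.cut i).weight ^ 2)

/-- The remainder `W = M - ∑ᵢ D⁽ⁱ⁾` of `M` in the cut decomposition given by `D`. -/
def CutFamily.remainder {n k : ℕ} (D : CutFamily n k) (M : Tensor n k) : Tensor n k :=
  fun t => M t - D.toTensor t

/-- In every cut array of the family the `k` sides are pairwise disjoint, so that the cut array is a
weighted complete `k`-partite hypergraph (for `k = 2`, a weighted complete bipartite graph). -/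
def CutFamily.IsPartite {n k : ℕ} (D : CutFamily n k) : Prop :=
  ∀ i, ∀ a b : Fin k, a ≠ b → Disjoint ((D.cut i).side a) ((D.cut i).side b)

/-- One cut decomposition for each of the `d ^ (2 k)` colours, each of error at most
`η n ^ (k / 2) ‖M‖_F` in the norm `∞ → 1`, where `M` is the interaction array of that colour. -/
def IsColoredCutDecomposition {n k r : ℕ} (H : LocalHamiltonian n k r) (η : ℝ)
    (D : (Fin k → PauliLabel r) → CutFamily n k) : Prop :=
  ∀ c, inftyOneNorm ((D c).remainder (H.colorTensor c)) ≤
    η * (n : ℝ) ^ ((k : ℝ) / 2) * frobNorm (H.colorTensor c)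

open Classical in
/-- The Hamiltonian of a coloured family of cut arrays,
`H_D = (1 / k!) ∑_c ∑_i ∑_t D^{c,i}_t (⊗ⱼ σ_{c j} at t j) ⊗ I`, with `t` ranging over the `k`-tuples of
distinct sites. -/
def cutHamiltonian {n k r : ℕ} (D : (Fin k → PauliLabel r) → CutFamily n k) :
    Matrix (Config n r) (Config n r) ℂ :=
  (1 / (k.factorial : ℂ)) • ∑ c, ∑ i : Fin (D c).width,
    ∑ t ∈ Finset.univ.filter (fun t : Fin k → Fin n => Function.Injective t),
      ((((D c).cut i).toTensor t : ℝ) : ℂ) • embedOp (tupleSupp t) (pauliLocal c t)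

end

noncomputable section

open scoped Matrix Matrix.Norms.L2Operator

/-! Both halves rest on averaging over site colourings `f : Fin n → Fin k`. A tuple `t` is
compatible with `f` when `f (t j) = j` for all `j`; an injective `t` is compatible with exactly `k ^
(n - k)` of the `k ^ n` colourings, other tuples with none. So a sum over injective tuples has norm
at most `k ^ k` times the largest norm of a compatible part (`norm_sum_injective_le`).

For the operator bound, fix a Pauli colour `c` and a colouring `f`. In the compatible terms every
site `u` carries either the identity or the single Pauli `pauli (c (f u))`. These terms are
therefore diagonal in one common product basis, and the diagonal entries of their sum are values of
the multilinear form of `W` at vectors with entries in `[-1, 1]`. This gives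
`norm_sum_coloring_pauli_le`. Summing over `c` through the Pauli expansion
`LocalHamiltonian.toMatrix_eq` bounds the spectral norm, which in turn dominates the error on
product states.

For existence, cut arrays on pairwise disjoint boxes are subtracted greedily
(`exists_partite_cutFamily`). Each step lowers the squared Frobenius norm, and this one energy
inequality controls width, coefficients and remainder. Testing only disjoint boxes suffices, again
by averaging over colourings (`inftyOneNorm_le_of_partite_boxSum`). -/

/-- The multilinear form of an array, evaluated at the vectors `x j`. -/
def multilinearSum {n k : ℕ} (W : Tensor n k) (x : Fin k → Fin n → ℝ) : ℝ :=
  ∑ t, W t * ∏ j, x j (t j)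

theorem abs_multilinearSum_le_sum_abs {n k : ℕ} (W : Tensor n k) {x : Fin k → Fin n → ℝ}
    (hx : ∀ j v, |x j v| ≤ 1) : |multilinearSum W x| ≤ ∑ t, |W t| := by
  refine (Finset.abs_sum_le_sum_abs _ _).trans (Finset.sum_le_sum fun t _ => ?_)
  rw [abs_mul, Finset.abs_prod]
  exact mul_le_of_le_one_right (abs_nonneg _)
    (Finset.prod_le_one (fun _ _ => abs_nonneg _) fun j _ => hx j _)

theorem abs_multilinearSum_le_inftyOneNorm {n k : ℕ} (W : Tensor n k) {x : Fin k → Fin n → ℝ}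
    (hx : ∀ j v, |x j v| ≤ 1) : |multilinearSum W x| ≤ inftyOneNorm W := by
  refine le_csSup ⟨∑ t, |W t|, ?_⟩ ⟨x, hx, rfl⟩
  rintro _ ⟨y, hy, rfl⟩
  exact abs_multilinearSum_le_sum_abs W hy

theorem inftyOneNorm_le {n k : ℕ} {W : Tensor n k} {b : ℝ}
    (h : ∀ x : Fin k → Fin n → ℝ, (∀ j v, |x j v| ≤ 1) → |multilinearSum W x| ≤ b) :
    inftyOneNorm W ≤ b := by
  refine csSup_le ⟨_, fun _ _ => 0, by simp, rfl⟩ ?_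
  rintro _ ⟨y, hy, rfl⟩
  exact h y hy

/-! ### Averaging over site colourings. -/

/-- The colours of the `k` sites of `t` are forced and the other `n - k` sites are free. -/
theorem card_coloring {n k : ℕ} {t : Fin k → Fin n} (ht : Function.Injective t) :
    (Finset.univ.filter fun f : Fin n → Fin k => ∀ j, f (t j) = j).card = k ^ (n - k) := by
  classical
  have h : (Finset.univ.filter fun f : Fin n → Fin k => ∀ j, f (t j) = j) =
      Fintype.piFinset fun v => if v ∈ tupleSupp t then
        Finset.univ.filter (fun j => t j = v) else Finset.univ := by
    ext f
    simp only [Finset.mem_filter, Finset.mem_univ, true_and, Fintype.mem_piFinset, tupleSupp,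
      Finset.mem_image]
    constructor
    · intro hf v
      split_ifs with hv
      · obtain ⟨j, rfl⟩ := hv
        simp [hf]
      · simp
    · intro hf j
      have := hf (t j)
      rw [if_pos ⟨j, rfl⟩] at this
      exact ht (by simpa using this)
  rw [h, Fintype.card_piFinset]
  have h1 : ∀ v, (if v ∈ tupleSupp t then Finset.univ.filter (fun j => t j = v)
      else Finset.univ : Finset (Fin k)).card = if v ∈ tupleSupp t then 1 else k := by
    intro v
    split_ifs with hv
    · obtain ⟨j, -, rfl⟩ := Finset.mem_image.1 hv
      simp only [ht.eq_iff, Finset.filter_eq', Finset.mem_univ, if_true,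
        Finset.card_singleton]
    · simp
  simp only [h1]
  rw [Finset.prod_ite]
  have h2 : (Finset.univ.filter fun v => v ∉ tupleSupp t) = (tupleSupp t)ᶜ := by ext; simp
  rw [h2, Finset.prod_const_one, one_mul, Finset.prod_const, Finset.card_compl, tupleSupp,
    Finset.card_image_of_injective _ ht]
  simp

open Classical in
theorem sum_coloring_sum {n k : ℕ} {E : Type*} [AddCommMonoid E] (F : (Fin k → Fin n) → E) :
    ∑ f : Fin n → Fin k, ∑ t, (if ∀ j, f (t j) = j then F t else 0) =
      k ^ (n - k) • ∑ t ∈ Finset.univ.filter (fun t : Fin k → Fin n => Function.Injective t),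
        F t := by
  rw [Finset.sum_comm, Finset.smul_sum, Finset.sum_filter]
  refine Finset.sum_congr rfl fun t _ => ?_
  split_ifs with ht
  · rw [← Finset.sum_filter, Finset.sum_const, card_coloring ht]
  · refine Finset.sum_eq_zero fun f _ => if_neg fun h => ht ?_
    intro a b hab
    rw [← h a, ← h b, hab]

open Classical in
theorem norm_sum_injective_le {n k : ℕ} (hk : 1 ≤ k) {E : Type*} [NormedAddCommGroup E]
    [NormedSpace ℝ E] (F : (Fin k → Fin n) → E) {b : ℝ}
    (h : ∀ f : Fin n → Fin k, ‖∑ t, (if ∀ j, f (t j) = j then F t else 0)‖ ≤ b) :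
    ‖∑ t ∈ Finset.univ.filter (fun t : Fin k → Fin n => Function.Injective t), F t‖ ≤
      (k : ℝ) ^ k * b := by
  have hb : 0 ≤ b := (norm_nonneg _).trans (h fun _ => ⟨0, hk⟩)
  have hk0 : (0 : ℝ) < k := by exact_mod_cast hk
  -- For `n < k` the exponent `n - k` truncates to `0`, but then there are no injective tuples at
  -- all.
  rcases lt_or_ge n k with hn | hn
  · rw [Finset.filter_false_of_mem, Finset.sum_empty, norm_zero]
    · positivity
    · intro t _ ht
      have := Fintype.card_le_of_injective t ht
      simp at this
      omega
  · have h1 := norm_sum_le_of_le Finset.univ fun f _ => h f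
    rw [sum_coloring_sum, ← Nat.cast_smul_eq_nsmul ℝ, norm_smul] at h1
    simp only [Finset.sum_const, Finset.card_univ, Fintype.card_fun, Fintype.card_fin,
      nsmul_eq_mul, Nat.cast_pow, norm_pow, Real.norm_natCast] at h1
    have h2 : (k : ℝ) ^ n = k ^ (n - k) * k ^ k := by rw [← pow_add, Nat.sub_add_cancel hn]
    rw [h2, mul_assoc] at h1
    exact le_of_mul_le_mul_left h1 (by positivity)

/-! ### From box sums to the `∞ → 1` norm. -/

theorem multilinearSum_update {n k : ℕ} (W : Tensor n k) (x : Fin k → Fin n → ℝ) (j : Fin k) :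
    ∃ a : Fin n → ℝ, ∀ y, multilinearSum W (Function.update x j y) = ∑ v, a v * y v := by
  refine ⟨fun v => ∑ t, if t j = v then W t * ∏ i ∈ Finset.univ.erase j, x i (t i) else 0,
    fun y => ?_⟩
  simp only [Finset.sum_mul, ite_mul, zero_mul]
  rw [Finset.sum_comm]
  refine Finset.sum_congr rfl fun t _ => ?_
  rw [Finset.sum_ite_eq, if_pos (Finset.mem_univ _),
    ← Finset.mul_prod_erase _ _ (Finset.mem_univ j), Function.update_self,
    Finset.prod_congr rfl fun i hi => by rw [Function.update_of_ne (Finset.ne_of_mem_erase hi)]]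
  ring

/-- A linear functional on the cube is at most twice its value at some vertex of `{0, 1} ^ n`. -/
theorem exists_abs_sum_le_two_mul_indicator {n : ℕ} (a y : Fin n → ℝ) (hy : ∀ v, |y v| ≤ 1) :
    ∃ S : Finset (Fin n), |∑ v, a v * y v| ≤ 2 * |∑ v, a v * if v ∈ S then 1 else 0| := by
  set P := Finset.univ.filter fun v => 0 ≤ a v
  set Q := Finset.univ.filter fun v => ¬ 0 ≤ a v
  have h1 : |∑ v, a v * y v| ≤ ∑ v, |a v| := by
    refine (Finset.abs_sum_le_sum_abs _ _).trans (Finset.sum_le_sum fun v _ => ?_)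
    rw [abs_mul]
    exact mul_le_of_le_one_right (abs_nonneg _) (hy v)
  have h2 : ∑ v, |a v| = ∑ v ∈ P, a v - ∑ v ∈ Q, a v := by
    rw [← Finset.sum_filter_add_sum_filter_not Finset.univ (fun v => 0 ≤ a v), sub_eq_add_neg,
      ← Finset.sum_neg_distrib]
    congr 1
    · exact Finset.sum_congr rfl fun v hv => abs_of_nonneg (Finset.mem_filter.1 hv).2
    · exact Finset.sum_congr rfl fun v hv => abs_of_neg (not_le.1 (Finset.mem_filter.1 hv).2)
  have h3 : ∀ S : Finset (Fin n), ∑ v, a v * (if v ∈ S then 1 else 0) = ∑ v ∈ S, a v := by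
    intro S
    simp
  simp only [h3]
  -- The positive and negative parts add up to `∑ v, |a v|`, so the larger one carries at least half
  -- of it.
  rcases le_total |∑ v ∈ P, a v| |∑ v ∈ Q, a v| with h | h
  · refine ⟨Q, ?_⟩
    linarith [le_abs_self (∑ v ∈ P, a v), neg_abs_le (∑ v ∈ Q, a v)]
  · refine ⟨P, ?_⟩
    linarith [le_abs_self (∑ v ∈ P, a v), neg_abs_le (∑ v ∈ Q, a v)]

/-- The sum of the entries of an array over a box. -/
def boxSum {n k : ℕ} (W : Tensor n k) (S : Fin k → Finset (Fin n)) : ℝ :=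
  ∑ t, if ∀ j, t j ∈ S j then W t else 0

theorem multilinearSum_indicator {n k : ℕ} (W : Tensor n k) (S : Fin k → Finset (Fin n)) :
    multilinearSum W (fun j v => if v ∈ S j then 1 else 0) = boxSum W S := by
  refine Finset.sum_congr rfl fun t _ => ?_
  rw [Finset.prod_ite_zero]
  simp

/-- The vectors are replaced by indicators one slot at a time, at a factor `2` each. In the
induction `J` is the set of slots that may not yet be indicators. -/
theorem abs_multilinearSum_le_of_boxSum {n k : ℕ} {W : Tensor n k} {β : ℝ}
    (h : ∀ S, |boxSum W S| ≤ β) {x : Fin k → Fin n → ℝ} (hx : ∀ j v, |x j v| ≤ 1) :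
    |multilinearSum W x| ≤ 2 ^ k * β := by
  suffices key : ∀ (J : Finset (Fin k)) (x : Fin k → Fin n → ℝ), (∀ j v, |x j v| ≤ 1) →
      (∀ j, j ∉ J → ∃ S : Finset (Fin n), x j = fun v => if v ∈ S then 1 else 0) →
      |multilinearSum W x| ≤ 2 ^ J.card * β by
    simpa using key Finset.univ x hx fun j hj => absurd (Finset.mem_univ j) hj
  intro J
  induction J using Finset.induction_on with
  | empty =>
    intro x _ hS
    choose S hS using fun j => hS j (Finset.notMem_empty j)
    have : x = fun j v => if v ∈ S j then 1 else 0 := funext hS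
    rw [this, multilinearSum_indicator]
    simpa using h S
  | insert j J hj ih =>
    intro x hx hS
    obtain ⟨a, ha⟩ := multilinearSum_update W x j
    obtain ⟨S, hSj⟩ := exists_abs_sum_le_two_mul_indicator a (x j) (hx j)
    rw [← ha, ← ha, Function.update_eq_self] at hSj
    have h1 : |multilinearSum W (Function.update x j fun v => if v ∈ S then 1 else 0)| ≤
        2 ^ J.card * β := by
      apply ih
      · intro i v
        rcases eq_or_ne i j with rfl | hij
        · rw [Function.update_self]
          split_ifs <;> simp
        · rw [Function.update_of_ne hij]
          exact hx i v
      · intro i hi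
        rcases eq_or_ne i j with rfl | hij
        · exact ⟨S, by rw [Function.update_self]⟩
        · rw [Function.update_of_ne hij]
          exact hS i (by simp [hij, hi])
    rw [Finset.card_insert_of_notMem hj, pow_succ]
    linarith

/-- Restricting to tuples compatible with `f` cuts each side `S j` down to the sites of colour `j`,
which makes the sides disjoint. -/
theorem inftyOneNorm_le_of_partite_boxSum {n k : ℕ} (hk : 1 ≤ k) {W : Tensor n k} {β : ℝ}
    (hW : ∀ t, ¬ Function.Injective t → W t = 0)
    (h : ∀ S : Fin k → Finset (Fin n), (∀ a b, a ≠ b → Disjoint (S a) (S b)) →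
      |boxSum W S| ≤ β) :
    inftyOneNorm W ≤ (k : ℝ) ^ k * (2 ^ k * β) := by
  classical
  refine inftyOneNorm_le fun x hx => ?_
  have h1 : multilinearSum W x = ∑ t ∈ Finset.univ.filter
      (fun t : Fin k → Fin n => Function.Injective t), W t * ∏ j, x j (t j) := by
    rw [Finset.sum_filter]
    refine Finset.sum_congr rfl fun t _ => ?_
    split_ifs with ht
    · rfl
    · rw [hW t ht, zero_mul]
  rw [h1, ← Real.norm_eq_abs]
  refine norm_sum_injective_le hk _ fun f => ?_
  rw [Real.norm_eq_abs]
  have h2 : ∑ t, (if ∀ j, f (t j) = j then W t * ∏ j, x j (t j) else 0) =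
      multilinearSum (fun t => if ∀ j, f (t j) = j then W t else 0) x := by
    refine Finset.sum_congr rfl fun t _ => ?_
    rw [ite_mul, zero_mul]
  rw [h2]
  refine abs_multilinearSum_le_of_boxSum (fun S => ?_) hx
  have h3 : boxSum (fun t => if ∀ j, f (t j) = j then W t else 0) S =
      boxSum W fun j => (S j).filter fun v => f v = j := by
    refine Finset.sum_congr rfl fun t _ => ?_
    simp only [Finset.mem_filter, forall_and, ite_and]
  rw [h3]
  refine h _ fun a b hab => Finset.disjoint_left.2 fun v hva hvb => hab ?_
  rw [← (Finset.mem_filter.1 hva).2, ← (Finset.mem_filter.1 hvb).2]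

/-! ### Greedy cut decomposition. -/

/-- The family with one more cut array. -/
def CutFamily.cons {n k : ℕ} (C : CutArray n k) (D : CutFamily n k) : CutFamily n k :=
  ⟨D.width + 1, Fin.cons C D.cut⟩

theorem CutFamily.sum_cons {n k : ℕ} (C : CutArray n k) (D : CutFamily n k)
    (g : CutArray n k → ℝ) :
    ∑ i, g ((CutFamily.cons C D).cut i) = g C + ∑ i, g (D.cut i) :=
  Fin.sum_univ_succ fun i : Fin (D.width + 1) =>
    g (Fin.cons (α := fun _ => CutArray n k) C D.cut i)

theorem CutFamily.remainder_cons {n k : ℕ} (C : CutArray n k) (D : CutFamily n k)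
    (M : Tensor n k) (t : Fin k → Fin n) :
    (CutFamily.cons C D).remainder M t = D.remainder M t - C.toTensor t := by
  have : (CutFamily.cons C D).toTensor t = C.toTensor t + D.toTensor t :=
    CutFamily.sum_cons C D fun C => C.toTensor t
  rw [CutFamily.remainder, CutFamily.remainder, this]
  ring

theorem CutFamily.IsPartite.cons {n k : ℕ} {C : CutArray n k} {D : CutFamily n k}
    (hD : D.IsPartite) (hC : ∀ a b, a ≠ b → Disjoint (C.side a) (C.side b)) :
    (CutFamily.cons C D).IsPartite := by
  intro i
  refine Fin.cases ?_ (fun i => ?_) i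
  · exact hC
  · exact hD i

theorem CutFamily.IsPartite.remainder_eq_zero {n k : ℕ} {D : CutFamily n k} (hD : D.IsPartite)
    {M : Tensor n k} {t : Fin k → Fin n} (hM : M t = 0) (ht : ¬ Function.Injective t) :
    D.remainder M t = 0 := by
  have : D.toTensor t = 0 := by
    refine Finset.sum_eq_zero fun i _ => if_neg fun h => ht ?_
    intro a b hab
    by_contra hne
    exact Finset.disjoint_left.1 (hD i a b hne) (h a) (hab ▸ h b)
  rw [CutFamily.remainder, hM, this, sub_zero]

/-- The weight `d` is the box sum divided by `n ^ k`, not by the size of the box. The energy drops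
by `2 * d * boxSum W S` minus `d ^ 2` times the box size, hence by at least `d ^ 2 * n ^ k`. Large
boxes thus get small weights, which keeps the coefficient length bounded. -/
theorem sum_sq_sub_cut_le {n k : ℕ} (W : Tensor n k) (S : Fin k → Finset (Fin n))
    (hN : (0 : ℝ) < (n : ℝ) ^ k) :
    (n : ℝ) ^ k * (boxSum W S / (n : ℝ) ^ k) ^ 2 +
      ∑ t, (W t - (CutArray.mk (boxSum W S / (n : ℝ) ^ k) S).toTensor t) ^ 2 ≤ ∑ t, W t ^ 2 := by
  set d := boxSum W S / (n : ℝ) ^ k with hd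
  have hb : boxSum W S = d * (n : ℝ) ^ k := by rw [hd, div_mul_cancel₀ _ hN.ne']
  have h1 : ∀ t, (W t - (CutArray.mk d S).toTensor t) ^ 2 ≤
      W t ^ 2 - 2 * d * (if ∀ j, t j ∈ S j then W t else 0) + d ^ 2 := by
    intro t
    simp only [CutArray.toTensor]
    split_ifs
    · nlinarith
    · nlinarith [sq_nonneg d]
  have h2 := Finset.sum_le_sum fun t (_ : t ∈ Finset.univ) => h1 t
  rw [Finset.sum_add_distrib, Finset.sum_sub_distrib, ← Finset.mul_sum, Finset.sum_const,
    Finset.card_univ, Fintype.card_fun, Fintype.card_fin, Fintype.card_fin, nsmul_eq_mul,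
    Nat.cast_pow] at h2
  have h3 : ∑ t, (if ∀ j, t j ∈ S j then W t else 0) = d * (n : ℝ) ^ k := hb
  rw [h3] at h2
  linarith

theorem CutFamily.width_mul_sq_le {n k : ℕ} {D : CutFamily n k} {M : Tensor n k} {δ : ℝ}
    (hδ : 0 < δ)
    (hE : (n : ℝ) ^ k * ∑ i, (D.cut i).weight ^ 2 + ∑ t, D.remainder M t ^ 2 ≤ ∑ t, M t ^ 2)
    (hw : ∀ i, δ ≤ |(D.cut i).weight| * (n : ℝ) ^ k) :
    D.width * δ ^ 2 ≤ (n : ℝ) ^ k * ∑ t, M t ^ 2 := by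
  have h1 : ∀ i, δ ^ 2 ≤ (n : ℝ) ^ k * ((n : ℝ) ^ k * (D.cut i).weight ^ 2) := by
    intro i
    calc δ ^ 2 ≤ (|(D.cut i).weight| * (n : ℝ) ^ k) ^ 2 := pow_le_pow_left₀ hδ.le (hw i) 2
      _ = _ := by rw [mul_pow, sq_abs]; ring
  have h2 := Finset.sum_le_sum fun i (_ : i ∈ Finset.univ) => h1 i
  rw [Finset.sum_const, Finset.card_univ, Fintype.card_fin, nsmul_eq_mul, ← Finset.mul_sum,
    ← Finset.mul_sum] at h2
  refine h2.trans (mul_le_mul_of_nonneg_left ?_ (by positivity))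
  linarith [Finset.sum_nonneg fun t (_ : t ∈ Finset.univ) => sq_nonneg (D.remainder M t)]

/-- Greedy cut decomposition, with an energy bound that controls width, coefficient length and
remainder at once. -/
theorem exists_partite_cutFamily {n k : ℕ} (M : Tensor n k) {δ : ℝ} (hδ : 0 < δ) :
    ∃ D : CutFamily n k, D.IsPartite ∧
      (n : ℝ) ^ k * ∑ i, (D.cut i).weight ^ 2 + ∑ t, D.remainder M t ^ 2 ≤ ∑ t, M t ^ 2 ∧
      D.width * δ ^ 2 ≤ (n : ℝ) ^ k * ∑ t, M t ^ 2 ∧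
      ∀ S : Fin k → Finset (Fin n), (∀ a b, a ≠ b → Disjoint (S a) (S b)) →
        |boxSum (D.remainder M) S| ≤ δ := by
  -- If no family worked, each admissible one could be extended by a violating box, giving families
  -- of every width, against `CutFamily.width_mul_sq_le`.
  by_contra! hno
  have key : ∀ s : ℕ, ∃ D : CutFamily n k, D.width = s ∧ D.IsPartite ∧
      (n : ℝ) ^ k * ∑ i, (D.cut i).weight ^ 2 + ∑ t, D.remainder M t ^ 2 ≤ ∑ t, M t ^ 2 ∧
      ∀ i, δ ≤ |(D.cut i).weight| * (n : ℝ) ^ k := by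
    intro s
    induction s with
    | zero =>
      refine ⟨⟨0, Fin.elim0⟩, rfl, fun i => i.elim0, ?_, fun i => i.elim0⟩
      simp [CutFamily.remainder, CutFamily.toTensor]
    | succ s ih =>
      obtain ⟨D, hs, hp, hE, hw⟩ := ih
      obtain ⟨S, hS, hlt⟩ := hno D hp hE (CutFamily.width_mul_sq_le hδ hE hw)
      have hN : (0 : ℝ) < (n : ℝ) ^ k := by
        by_contra hN
        have hN0 : (n ^ k : ℕ) = 0 := by
          have : (n : ℝ) ^ k = 0 := le_antisymm (not_lt.1 hN) (by positivity)
          exact_mod_cast this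
        have : IsEmpty (Fin k → Fin n) := by
          rw [← Fintype.card_eq_zero_iff]
          simpa using hN0
        simp [boxSum] at hlt
        linarith
      set d := boxSum (D.remainder M) S / (n : ℝ) ^ k with hd
      have habs : |d| * (n : ℝ) ^ k = |boxSum (D.remainder M) S| := by
        rw [hd, abs_div, abs_of_pos hN, div_mul_cancel₀ _ hN.ne']
      refine ⟨CutFamily.cons ⟨d, S⟩ D, by simp [CutFamily.cons, hs], hp.cons hS, ?_, ?_⟩
      · simp only [CutFamily.remainder_cons]
        have h1 : ∑ i, ((CutFamily.cons ⟨d, S⟩ D).cut i).weight ^ 2 =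
            d ^ 2 + ∑ i, (D.cut i).weight ^ 2 :=
          CutFamily.sum_cons _ D fun C => C.weight ^ 2
        have h2 := sum_sq_sub_cut_le (D.remainder M) S hN
        rw [← hd] at h2
        rw [h1]
        linarith
      · intro i
        refine Fin.cases ?_ (fun i => ?_) i
        · exact hlt.le.trans habs.ge
        · exact hw i
  obtain ⟨s, hs⟩ := exists_nat_gt (((n : ℝ) ^ k * ∑ t, M t ^ 2) / δ ^ 2)
  obtain ⟨D, rfl, -, hE, hw⟩ := key s
  rw [div_lt_iff₀ (by positivity)] at hs
  exact absurd (CutFamily.width_mul_sq_le hδ hE hw) (not_le.2 hs)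

/-! ### Tensor products of matrices. -/

/-- The tensor product of a family of square matrices. -/
def piMatrix {ι κ : Type*} [Fintype ι] (A : ι → Matrix κ κ ℂ) : Matrix (ι → κ) (ι → κ) ℂ :=
  fun x y => ∏ i, A i (x i) (y i)

theorem sum_pi_prod {ι κ : Type*} [Fintype ι] [DecidableEq ι] [Fintype κ]
    {R : Type*} [CommSemiring R] (g : ι → κ → R) :
    ∑ x : ι → κ, ∏ i, g i (x i) = ∏ i, ∑ a, g i a := by
  rw [Finset.prod_univ_sum, Fintype.piFinset_univ]

theorem piMatrix_mul {ι κ : Type*} [Fintype ι] [DecidableEq ι]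
    [Fintype κ] [DecidableEq κ] (A B : ι → Matrix κ κ ℂ) :
    piMatrix A * piMatrix B = piMatrix fun i => A i * B i := by
  ext x y
  simp only [Matrix.mul_apply, piMatrix, ← Finset.prod_mul_distrib]
  exact sum_pi_prod fun i a => A i (x i) a * B i a (y i)

theorem piMatrix_diagonal {ι κ : Type*} [Fintype ι] [DecidableEq κ] (v : ι → κ → ℂ) :
    piMatrix (fun i => Matrix.diagonal (v i)) = Matrix.diagonal fun x => ∏ i, v i (x i) := by
  ext x y
  simp only [piMatrix, Matrix.diagonal_apply]
  rw [Finset.prod_ite_zero]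
  simp [funext_iff]

theorem piMatrix_one {ι κ : Type*} [Fintype ι] [DecidableEq ι]
    [Fintype κ] [DecidableEq κ] : piMatrix (fun _ : ι => (1 : Matrix κ κ ℂ)) = 1 := by
  simpa [← Matrix.diagonal_one] using piMatrix_diagonal fun (_ : ι) (_ : κ) => (1 : ℂ)

theorem piMatrix_conjTranspose {ι κ : Type*} [Fintype ι] (A : ι → Matrix κ κ ℂ) :
    (piMatrix A)ᴴ = piMatrix fun i => (A i)ᴴ := by
  ext x y
  simp [piMatrix, Matrix.conjTranspose_apply]

theorem piMatrix_mem_unitary {ι κ : Type*} [Fintype ι] [DecidableEq ι]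
    [Fintype κ] [DecidableEq κ] {U : ι → Matrix κ κ ℂ} (hU : ∀ i, U i ∈ unitary (Matrix κ κ ℂ)) :
    piMatrix U ∈ unitary (Matrix (ι → κ) (ι → κ) ℂ) := by
  rw [Unitary.mem_iff, Matrix.star_eq_conjTranspose, piMatrix_conjTranspose, piMatrix_mul,
    piMatrix_mul]
  constructor
  · rw [← piMatrix_one]
    exact congrArg _ (funext fun i => (Unitary.mem_iff.1 (hU i)).1)
  · rw [← piMatrix_one]
    exact congrArg _ (funext fun i => (Unitary.mem_iff.1 (hU i)).2)

theorem piMatrix_conj_diagonal {ι κ : Type*} [Fintype ι] [DecidableEq ι]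
    [Fintype κ] [DecidableEq κ] (U : ι → Matrix κ κ ℂ) (v : ι → κ → ℂ) :
    piMatrix (fun i => U i * Matrix.diagonal (v i) * (U i)ᴴ) =
      piMatrix U * Matrix.diagonal (fun x => ∏ i, v i (x i)) * (piMatrix U)ᴴ := by
  rw [piMatrix_conjTranspose, ← piMatrix_diagonal, piMatrix_mul, piMatrix_mul]

/-! ### Spectral norm and trace estimates. -/

section SpectralNorm

variable {ι : Type*} [Fintype ι] [DecidableEq ι]

theorem norm_apply_le_l2_opNorm (A : Matrix ι ι ℂ) (i j : ι) : ‖A i j‖ ≤ ‖A‖ := by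
  have h := A.l2_opNorm_mulVec (EuclideanSpace.single j (1 : ℂ))
  have h1 := (PiLp.norm_apply_le ((EuclideanSpace.equiv ι ℂ).symm
    (A *ᵥ (EuclideanSpace.single j (1 : ℂ)))) i).trans h
  simpa using h1

theorem norm_trace_mul_le_of_unitary (A : Matrix ι ι ℂ) {U : Matrix ι ι ℂ}
    (hU : U ∈ unitary (Matrix ι ι ℂ)) : ‖(A * U).trace‖ ≤ Fintype.card ι * ‖A‖ := by
  refine (norm_sum_le _ _).trans ?_
  rw [← nsmul_eq_mul, ← Finset.card_univ]
  refine Finset.sum_le_card_nsmul _ _ _ fun i _ => ?_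
  rw [← CStarRing.norm_mul_mem_unitary A hU]
  exact norm_apply_le_l2_opNorm _ _ _

theorem norm_conj_diagonal_le {U : Matrix ι ι ℂ} (hU : U ∈ unitary (Matrix ι ι ℂ)) {v : ι → ℂ}
    {b : ℝ} (hb : 0 ≤ b) (hv : ∀ i, ‖v i‖ ≤ b) : ‖U * Matrix.diagonal v * Uᴴ‖ ≤ b := by
  have hU' : Uᴴ ∈ unitary (Matrix ι ι ℂ) := Unitary.star_mem hU
  rw [CStarRing.norm_mul_mem_unitary _ hU', CStarRing.norm_mem_unitary_mul _ hU,
    Matrix.l2_opNorm_diagonal]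
  exact (pi_norm_le_iff_of_nonneg hb).2 hv

/-- By cyclicity the trace is `∑ i, (Uᴴ * X * U) i i * v i`, and matrix entries are bounded by the
norm. -/
theorem norm_trace_mul_conj_diagonal_le (X : Matrix ι ι ℂ) {U : Matrix ι ι ℂ}
    (hU : U ∈ unitary (Matrix ι ι ℂ)) (v : ι → ℂ) :
    ‖(X * (U * Matrix.diagonal v * Uᴴ)).trace‖ ≤ ‖X‖ * ∑ i, ‖v i‖ := by
  have hU' : Uᴴ ∈ unitary (Matrix ι ι ℂ) := Unitary.star_mem hU
  rw [← Matrix.mul_assoc, Matrix.trace_mul_comm, ← Matrix.mul_assoc, ← Matrix.mul_assoc,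
    Matrix.trace, Finset.mul_sum]
  refine norm_sum_le_of_le _ fun i _ => ?_
  rw [Matrix.diag_apply, Matrix.mul_diagonal, norm_mul]
  refine mul_le_mul_of_nonneg_right ?_ (norm_nonneg _)
  refine (norm_apply_le_l2_opNorm _ _ _).trans_eq ?_
  rw [CStarRing.norm_mul_mem_unitary _ hU, CStarRing.norm_mem_unitary_mul _ hU']

theorem Matrix.IsHermitian.eq_conj_diagonal {A : Matrix ι ι ℂ} (hA : A.IsHermitian) :
    A = (hA.eigenvectorUnitary : Matrix ι ι ℂ) *
      Matrix.diagonal (fun i => (hA.eigenvalues i : ℂ)) *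
      (hA.eigenvectorUnitary : Matrix ι ι ℂ)ᴴ := by
  have h := hA.spectral_theorem
  rw [Unitary.conjStarAlgAut_apply] at h
  exact h

theorem Matrix.IsHermitian.abs_eigenvalues_le {A : Matrix ι ι ℂ} (hA : A.IsHermitian)
    (hA2 : A * A = 1) (i : ι) : |hA.eigenvalues i| ≤ 1 := by
  have hU := hA.eigenvectorUnitary.2
  have h := hA.eq_conj_diagonal
  have hA' : A ∈ unitary (Matrix ι ι ℂ) := by
    rw [Unitary.mem_iff, Matrix.star_eq_conjTranspose, hA.eq]
    exact ⟨hA2, hA2⟩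
  have hU' : (hA.eigenvectorUnitary : Matrix ι ι ℂ)ᴴ ∈ unitary (Matrix ι ι ℂ) :=
    Unitary.star_mem hU
  have h1 : ‖A‖ = ‖fun i => (hA.eigenvalues i : ℂ)‖ := by
    conv_lhs => rw [h]
    rw [CStarRing.norm_mul_mem_unitary _ hU', CStarRing.norm_mem_unitary_mul _ hU,
      Matrix.l2_opNorm_diagonal]
  have h2 := norm_le_pi_norm (fun i => (hA.eigenvalues i : ℂ)) i
  have : Nontrivial (Matrix ι ι ℂ) := by
    have : Nonempty ι := ⟨i⟩
    infer_instance
  rw [← h1, CStarRing.norm_of_mem_unitary hA'] at h2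
  simpa using h2

end SpectralNorm

/-! ### Pauli operators and sums of them over compatible tuples. -/

section Pauli

theorem qubitPauli_conjTranspose (p : Fin 4) : (qubitPauli p)ᴴ = qubitPauli p := by
  ext i j
  fin_cases p <;> fin_cases i <;> fin_cases j <;> simp [qubitPauli]

theorem qubitPauli_mul_self (p : Fin 4) : qubitPauli p * qubitPauli p = 1 := by
  ext i j
  fin_cases p <;> fin_cases i <;> fin_cases j <;> simp [qubitPauli, Matrix.mul_apply]

theorem sum_qubitPauli_mul (a b x y : Fin 2) :
    ∑ p, qubitPauli p b a * qubitPauli p x y = if b = y ∧ a = x then 2 else 0 := by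
  fin_cases a <;> fin_cases b <;> fin_cases x <;> fin_cases y <;>
    simp [Fin.sum_univ_four, qubitPauli] <;> norm_num

variable {r : ℕ}

theorem pauli_eq_piMatrix (p : PauliLabel r) : pauli p = piMatrix fun a => qubitPauli (p a) := rfl

theorem pauli_isHermitian (p : PauliLabel r) : (pauli p).IsHermitian := by
  rw [Matrix.IsHermitian, pauli_eq_piMatrix, piMatrix_conjTranspose]
  simp only [qubitPauli_conjTranspose]

theorem pauli_mul_self (p : PauliLabel r) : pauli p * pauli p = 1 := by
  rw [pauli_eq_piMatrix, piMatrix_mul]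
  simp only [qubitPauli_mul_self, piMatrix_one]

theorem sum_pauli_mul (a b x y : Qudit r) :
    ∑ p, pauli p b a * pauli p x y = if b = y ∧ a = x then 2 ^ r else 0 := by
  simp only [pauli, ← Finset.prod_mul_distrib]
  rw [sum_pi_prod fun i p => qubitPauli p (b i) (a i) * qubitPauli p (x i) (y i)]
  simp only [sum_qubitPauli_mul]
  rw [Finset.prod_ite_zero]
  simp [funext_iff, forall_and]

variable {n k : ℕ}

theorem bijective_toSupp {t : Fin k → Fin n} (ht : Function.Injective t) :
    Function.Bijective fun j : Fin k =>
      (⟨t j, Finset.mem_image_of_mem t (Finset.mem_univ j)⟩ : tupleSupp t) := by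
  refine ⟨fun a b hab => ht (Subtype.ext_iff.1 hab), fun ⟨v, hv⟩ => ?_⟩
  obtain ⟨j, -, rfl⟩ := Finset.mem_image.1 hv
  exact ⟨j, rfl⟩

/-- Local configurations on the sites of a tuple, indexed by the positions in the tuple. -/
def suppEquiv (r : ℕ) {t : Fin k → Fin n} (ht : Function.Injective t) :
    (tupleSupp t → Qudit r) ≃ (Fin k → Qudit r) :=
  (Equiv.ofBijective _ (bijective_toSupp ht)).symm.arrowCongr (Equiv.refl _)

theorem pauliLocal_eq_submatrix (c : Fin k → PauliLabel r) {t : Fin k → Fin n}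
    (ht : Function.Injective t) :
    pauliLocal c t =
      (piMatrix fun j => pauli (c j)).submatrix (suppEquiv r ht) (suppEquiv r ht) := rfl

theorem pauliLocal_isHermitian (c : Fin k → PauliLabel r) {t : Fin k → Fin n}
    (ht : Function.Injective t) : (pauliLocal c t).IsHermitian := by
  rw [Matrix.IsHermitian, pauliLocal_eq_submatrix c ht, Matrix.conjTranspose_submatrix,
    piMatrix_conjTranspose]
  simp only [(pauli_isHermitian _).eq]

theorem pauliLocal_mem_unitary (c : Fin k → PauliLabel r) {t : Fin k → Fin n}
    (ht : Function.Injective t) : pauliLocal c t ∈ unitary _ := by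
  have h : pauliLocal c t * pauliLocal c t = 1 := by
    rw [pauliLocal_eq_submatrix c ht, Matrix.submatrix_mul_equiv, piMatrix_mul]
    simp only [pauli_mul_self, piMatrix_one, Matrix.submatrix_one_equiv]
  rw [Unitary.mem_iff, Matrix.star_eq_conjTranspose, (pauliLocal_isHermitian c ht).eq]
  exact ⟨h, h⟩

/-- Completeness of the Pauli operators. -/
theorem sum_trace_smul_pauliLocal {t : Fin k → Fin n} (ht : Function.Injective t)
    (A : Matrix (tupleSupp t → Qudit r) (tupleSupp t → Qudit r) ℂ) :
    ∑ c : Fin k → PauliLabel r, ((A * pauliLocal c t).trace / ((2 : ℂ) ^ r) ^ k) •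
      pauliLocal c t = A := by
  ext x y
  have key : ∀ a b : tupleSupp t → Qudit r,
      ∑ c : Fin k → PauliLabel r, pauliLocal c t b a * pauliLocal c t x y =
        if b = y ∧ a = x then ((2 : ℂ) ^ r) ^ k else 0 := by
    intro a b
    simp only [pauliLocal_eq_submatrix _ ht, Matrix.submatrix_apply, piMatrix,
      ← Finset.prod_mul_distrib]
    rw [sum_pi_prod fun j p => pauli p (suppEquiv r ht b j) (suppEquiv r ht a j) *
      pauli p (suppEquiv r ht x j) (suppEquiv r ht y j)]
    simp only [sum_pauli_mul]
    rw [Finset.prod_ite_zero]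
    have hinj : ∀ z w : tupleSupp t → Qudit r,
        (∀ j, suppEquiv r ht z j = suppEquiv r ht w j) ↔ z = w := fun z w => by
      rw [← funext_iff, (suppEquiv r ht).injective.eq_iff]
    simp only [Finset.mem_univ, true_imp_iff, forall_and, hinj, Finset.prod_const,
      Finset.card_univ, Fintype.card_fin]
  have h2 : ((2 : ℂ) ^ r) ^ k ≠ 0 := pow_ne_zero _ (pow_ne_zero _ two_ne_zero)
  calc (∑ c : Fin k → PauliLabel r, ((A * pauliLocal c t).trace / ((2 : ℂ) ^ r) ^ k) •
        pauliLocal c t) x y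
      = ∑ c : Fin k → PauliLabel r, ∑ a, ∑ b,
          A a b * (pauliLocal c t b a * pauliLocal c t x y) / ((2 : ℂ) ^ r) ^ k := by
        rw [Matrix.sum_apply]
        refine Finset.sum_congr rfl fun c _ => ?_
        simp only [Matrix.smul_apply, smul_eq_mul, Matrix.trace, Matrix.diag_apply,
          Matrix.mul_apply, Finset.sum_div, Finset.sum_mul]
        refine Finset.sum_congr rfl fun a _ => Finset.sum_congr rfl fun b _ => ?_
        ring
    _ = ∑ a, ∑ b, A a b * (if b = y ∧ a = x then ((2 : ℂ) ^ r) ^ k else 0) /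
          ((2 : ℂ) ^ r) ^ k := by
        rw [Finset.sum_comm]
        refine Finset.sum_congr rfl fun a _ => ?_
        rw [Finset.sum_comm]
        refine Finset.sum_congr rfl fun b _ => ?_
        rw [← key, Finset.mul_sum, Finset.sum_div]
    _ = A x y := by
        rw [Finset.sum_eq_single x, Finset.sum_eq_single y]
        · rw [if_pos ⟨rfl, rfl⟩, mul_div_cancel_right₀ _ h2]
        · intro b _ hb
          simp [hb]
        · simp
        · intro a _ ha
          simp [ha]
        · simp

theorem ofReal_re_trace_mul {ι : Type*} [Fintype ι] {A B : Matrix ι ι ℂ} (hA : A.IsHermitian)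
    (hB : B.IsHermitian) : ((A * B).trace.re : ℂ) = (A * B).trace := by
  refine Complex.conj_eq_iff_re.1 ?_
  rw [starRingEnd_apply, ← Matrix.trace_conjTranspose, Matrix.conjTranspose_mul, hA.eq, hB.eq,
    Matrix.trace_mul_comm]

/-- Compatibility lets the Pauli at a site be read off from the site alone, independently of `t`. -/
theorem embedOp_pauliLocal (c : Fin k → PauliLabel r) {t : Fin k → Fin n} {f : Fin n → Fin k}
    (hf : ∀ j, f (t j) = j) :
    embedOp (tupleSupp t) (pauliLocal c t) =
      piMatrix fun u => if u ∈ tupleSupp t then pauli (c (f u)) else 1 := by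
  have ht : Function.Injective t := Function.LeftInverse.injective hf
  ext x y
  have h1 : piMatrix (fun u => if u ∈ tupleSupp t then pauli (c (f u)) else 1) x y =
      ∏ u, if u ∈ tupleSupp t then pauli (c (f u)) (x u) (y u)
        else if x u = y u then (1 : ℂ) else 0 := by
    refine Finset.prod_congr rfl fun u _ => ?_
    split_ifs with h h' <;> simp [Matrix.one_apply, *]
  have h0 : (Finset.univ.filter fun u => u ∈ tupleSupp t) = tupleSupp t := by ext; simp
  rw [h1, Finset.prod_ite, Finset.prod_ite_zero, h0]
  have h2 : ∏ u ∈ tupleSupp t, pauli (c (f u)) (x u) (y u) =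
      ∏ j, pauli (c j) (x (t j)) (y (t j)) := by
    rw [tupleSupp, Finset.prod_image fun a _ b _ h => ht h]
    simp only [hf]
  rw [h2]
  simp [embedOp, pauliLocal]

theorem norm_sum_coloring_pauli_le (W : Tensor n k) (c : Fin k → PauliLabel r)
    (f : Fin n → Fin k) :
    ‖∑ t, (if ∀ j, f (t j) = j then (W t : ℂ) • embedOp (tupleSupp t) (pauliLocal c t)
      else 0)‖ ≤ inftyOneNorm W := by
  have hP : ∀ u, (pauli (c (f u))).IsHermitian := fun u => pauli_isHermitian _
  set U : Fin n → Matrix (Qudit r) (Qudit r) ℂ := fun u => (hP u).eigenvectorUnitary with hU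
  have hUu : ∀ u, U u ∈ unitary _ := fun u => (hP u).eigenvectorUnitary.2
  -- Slot `j` sees only sites of colour `j`, so incompatible tuples drop out of the multilinear form
  -- by themselves.
  set x : Config n r → Fin k → Fin n → ℝ :=
    fun z j v => if f v = j then (hP v).eigenvalues (z v) else 0 with hx
  have h1 : ∑ t, (if ∀ j, f (t j) = j then (W t : ℂ) •
      embedOp (tupleSupp t) (pauliLocal c t) else 0) =
      piMatrix U * Matrix.diagonal (fun z => ((multilinearSum W (x z) : ℝ) : ℂ)) *
        (piMatrix U)ᴴ := by
    have h2 : Matrix.diagonal (fun z => ((multilinearSum W (x z) : ℝ) : ℂ)) =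
        ∑ t, Matrix.diagonal (fun z => ((W t * ∏ j, x z j (t j) : ℝ) : ℂ)) := by
      ext a b
      rw [Matrix.sum_apply]
      simp only [Matrix.diagonal_apply]
      split_ifs
      · simp [multilinearSum]
      · simp
    rw [h2, Finset.mul_sum, Finset.sum_mul]
    refine Finset.sum_congr rfl fun t _ => ?_
    split_ifs with hf
    · have ht : Function.Injective t := Function.LeftInverse.injective hf
      rw [embedOp_pauliLocal c hf]
      have h3 : (fun u => if u ∈ tupleSupp t then pauli (c (f u)) else 1) =
          fun u => U u * Matrix.diagonal (fun a => if u ∈ tupleSupp t then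
            ((hP u).eigenvalues a : ℂ) else 1) * (U u)ᴴ := by
        funext u
        split_ifs
        · exact (hP u).eq_conj_diagonal
        · rw [Matrix.diagonal_one, mul_one]
          exact (Unitary.mem_iff.1 (hUu u)).2.symm
      rw [h3, piMatrix_conj_diagonal, ← Matrix.smul_mul, ← Matrix.mul_smul,
        ← Matrix.diagonal_smul]
      congr 3
      funext z
      simp only [Pi.smul_apply, smul_eq_mul, Finset.prod_ite_mem, Finset.univ_inter]
      rw [tupleSupp, Finset.prod_image fun a _ b _ h => ht h]
      simp [hx, hf]
    · have h4 : ∀ z, ∏ j, x z j (t j) = 0 := by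
        intro z
        obtain ⟨j, hj⟩ := not_forall.1 hf
        exact Finset.prod_eq_zero (Finset.mem_univ j) (if_neg hj)
      simp [h4]
  have hb : ∀ z, |multilinearSum W (x z)| ≤ inftyOneNorm W := by
    refine fun z => abs_multilinearSum_le_inftyOneNorm W fun j v => ?_
    simp only [hx]
    split_ifs
    · exact (hP v).abs_eigenvalues_le (pauli_mul_self _) _
    · simp
  rw [h1]
  refine norm_conj_diagonal_le (piMatrix_mem_unitary hUu)
    ((abs_nonneg _).trans (hb fun _ _ => 0)) fun z => ?_
  simpa using hb z

open Classical in
theorem norm_sum_injective_pauli_le (hk : 1 ≤ k) (W : Tensor n k) (c : Fin k → PauliLabel r) :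
    ‖∑ t ∈ Finset.univ.filter (fun t : Fin k → Fin n => Function.Injective t),
      (W t : ℂ) • embedOp (tupleSupp t) (pauliLocal c t)‖ ≤ (k : ℝ) ^ k * inftyOneNorm W :=
  norm_sum_injective_le hk _ fun f => by
    convert norm_sum_coloring_pauli_le W c f

/-- A product state is diagonal in a product basis, with eigenvalues that form a product probability
distribution. -/
theorem norm_trace_mul_tensorOp_le (X : Matrix (Config n r) (Config n r) ℂ)
    {ρ : Fin n → Matrix (Qudit r) (Qudit r) ℂ} (hρ : ∀ u, IsDensity (ρ u)) :
    ‖(X * tensorOp ρ).trace‖ ≤ ‖X‖ := by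
  have hP : ∀ u, (ρ u).IsHermitian := fun u => (hρ u).1.1
  have h1 : tensorOp ρ = piMatrix (fun u => ((hP u).eigenvectorUnitary : Matrix _ _ ℂ)) *
      Matrix.diagonal (fun z => ∏ u, ((hP u).eigenvalues (z u) : ℂ)) *
      (piMatrix fun u => ((hP u).eigenvectorUnitary : Matrix _ _ ℂ))ᴴ := by
    rw [← piMatrix_conj_diagonal _ fun u a => ((hP u).eigenvalues a : ℂ)]
    exact congrArg piMatrix (funext fun u => (hP u).eq_conj_diagonal)
  rw [h1]
  refine (norm_trace_mul_conj_diagonal_le X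
    (piMatrix_mem_unitary fun u => (hP u).eigenvectorUnitary.2) _).trans_eq ?_
  have h2 : ∀ u, ∑ a, (hP u).eigenvalues a = 1 := by
    intro u
    have h := (hP u).trace_eq_sum_eigenvalues
    rw [(hρ u).2] at h
    apply_fun Complex.re at h
    simpa using h.symm
  have h3 : ∀ z : Config n r, ‖∏ u, ((hP u).eigenvalues (z u) : ℂ)‖ =
      ∏ u, (hP u).eigenvalues (z u) := by
    intro z
    rw [norm_prod]
    refine Finset.prod_congr rfl fun u _ => ?_
    rw [Complex.norm_real, Real.norm_eq_abs, abs_of_nonneg ((hρ u).1.eigenvalues_nonneg _)]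
  simp only [h3]
  rw [sum_pi_prod fun u a => (hP u).eigenvalues a]
  simp [h2]

end Pauli

/-! ### Orderings of hyperedges and the Pauli expansion. -/

theorem injective_of_card_tupleSupp {n k : ℕ} {t : Fin k → Fin n} (h : (tupleSupp t).card = k) :
    Function.Injective t := by
  rw [← Set.injOn_univ, ← Finset.coe_univ, ← Finset.card_image_iff]
  simpa [tupleSupp] using h

theorem card_tupleSupp_eq {n k : ℕ} {e : Finset (Fin n)} (he : e.card = k) :
    (Finset.univ.filter fun t : Fin k → Fin n => tupleSupp t = e).card = k.factorial := by
  have h : Fintype.card (Fin k ↪ e) = k.factorial := by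
    rw [Fintype.card_embedding_eq, Fintype.card_coe, he, Fintype.card_fin, Nat.descFactorial_self]
  rw [← h, ← Finset.card_univ]
  symm
  refine Finset.card_bij (fun g _ j => (g j : Fin n)) ?_ ?_ ?_
  · intro g _
    rw [Finset.mem_filter]
    refine ⟨Finset.mem_univ _, Finset.eq_of_subset_of_card_le ?_ ?_⟩
    · intro v hv
      obtain ⟨j, -, rfl⟩ := Finset.mem_image.1 hv
      exact (g j).2
    · have hg : Function.Injective fun j => (g j : Fin n) :=
        Subtype.val_injective.comp g.injective
      rw [tupleSupp, Finset.card_image_of_injective _ hg, he]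
      simp
  · intro g _ g' _ hgg
    ext j
    exact congrArg Fin.val (congrFun hgg j)
  · intro t ht
    have hte := (Finset.mem_filter.1 ht).2
    have hinj := injective_of_card_tupleSupp (hte.symm ▸ he : (tupleSupp t).card = k)
    refine ⟨⟨fun j => ⟨t j, ?_⟩, fun a b hab => hinj (Subtype.ext_iff.1 hab)⟩,
      Finset.mem_univ _, rfl⟩
    rw [← hte]
    exact Finset.mem_image_of_mem t (Finset.mem_univ j)

theorem sum_tuples_eq {n k : ℕ} {E : Type*} [AddCommMonoid E] {s : Finset (Finset (Fin n))}
    (hs : ∀ e ∈ s, e.card = k) (F : Finset (Fin n) → E) :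
    ∑ t : Fin k → Fin n, (if tupleSupp t ∈ s then F (tupleSupp t) else 0) =
      k.factorial • ∑ e ∈ s, F e := by
  rw [← Finset.sum_filter, Finset.smul_sum,
    ← Finset.sum_fiberwise_of_maps_to (g := fun t : Fin k → Fin n => tupleSupp t) (t := s)
      fun t ht => (Finset.mem_filter.1 ht).2]
  refine Finset.sum_congr rfl fun e he => ?_
  rw [← card_tupleSupp_eq (hs e he), ← Finset.sum_const, Finset.filter_filter]
  refine Finset.sum_congr ?_ fun t ht => ?_
  · ext t
    simp only [Finset.mem_filter, Finset.mem_univ, true_and]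
    exact ⟨fun h => h.2, fun h => ⟨h.symm ▸ he, h⟩⟩
  · rw [(Finset.mem_filter.1 ht).2]

namespace LocalHamiltonian

variable {n k r : ℕ} (H : LocalHamiltonian n k r)

theorem injective_of_mem {t : Fin k → Fin n} (ht : tupleSupp t ∈ H.edges) :
    Function.Injective t :=
  injective_of_card_tupleSupp (H.card_edge _ ht)

theorem colorTensor_eq_zero (c : Fin k → PauliLabel r) {t : Fin k → Fin n}
    (ht : ¬ Function.Injective t) : H.colorTensor c t = 0 :=
  if_neg fun h => ht (H.injective_of_mem h)

theorem abs_colorTensor_le (c : Fin k → PauliLabel r) {t : Fin k → Fin n}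
    (ht : tupleSupp t ∈ H.edges) :
    |H.colorTensor c t| ≤ matrixSpectralNorm (H.term (tupleSupp t)) := by
  have h1 := norm_trace_mul_le_of_unitary (H.term (tupleSupp t))
    (pauliLocal_mem_unitary c (H.injective_of_mem ht))
  have h2 : (Fintype.card (tupleSupp t → Qudit r) : ℝ) = ((2 : ℝ) ^ r) ^ k := by
    simp [H.card_edge _ ht]
  rw [h2] at h1
  rw [colorTensor, if_pos ht, abs_div, abs_of_pos (by positivity : (0 : ℝ) < (2 ^ r) ^ k),
    div_le_iff₀ (by positivity), mul_comm]
  exact (Complex.abs_re_le_norm _).trans h1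

/-- Each hyperedge has `k!` orderings. The square root of `k!` would do; the cruder factor cancels
the `1 / k!` of the expansion. -/
theorem frobNorm_colorTensor_le (c : Fin k → PauliLabel r) :
    frobNorm (H.colorTensor c) ≤ k.factorial * H.strengthNorm := by
  have h1 : ∑ t, H.colorTensor c t ^ 2 ≤
      k.factorial * ∑ e ∈ H.edges, matrixSpectralNorm (H.term e) ^ 2 := by
    rw [← nsmul_eq_mul, ← sum_tuples_eq H.card_edge]
    refine Finset.sum_le_sum fun t _ => ?_
    split_ifs with ht
    · rw [← sq_abs]
      exact pow_le_pow_left₀ (abs_nonneg _) (H.abs_colorTensor_le c ht) 2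
    · simp [colorTensor, ht]
  have hk : (1 : ℝ) ≤ k.factorial := by exact_mod_cast Nat.one_le_iff_ne_zero.2 k.factorial_ne_zero
  have h0 : 0 ≤ ∑ e ∈ H.edges, matrixSpectralNorm (H.term e) ^ 2 :=
    Finset.sum_nonneg fun _ _ => sq_nonneg _
  refine Real.sqrt_le_iff.2 ⟨mul_nonneg (by positivity) (Real.sqrt_nonneg _), h1.trans ?_⟩
  rw [mul_pow, strengthNorm, Real.sq_sqrt h0, sq, mul_assoc]
  exact le_mul_of_one_le_left (by positivity) hk

theorem sum_colorTensor_smul {t : Fin k → Fin n} (ht : tupleSupp t ∈ H.edges) :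
    ∑ c, (H.colorTensor c t : ℂ) • pauliLocal c t = H.term (tupleSupp t) := by
  have hinj := H.injective_of_mem ht
  conv_rhs => rw [← sum_trace_smul_pauliLocal hinj (H.term (tupleSupp t))]
  refine Finset.sum_congr rfl fun c _ => ?_
  rw [colorTensor, if_pos ht, ← ofReal_re_trace_mul (H.isHermitian _ ht)
    (pauliLocal_isHermitian c hinj)]
  push_cast
  rfl

end LocalHamiltonian

theorem embedOp_sum_smul {n r : ℕ} {κ : Type*} (s : Finset κ) (e : Finset (Fin n)) (a : κ → ℂ)
    (A : κ → Matrix (e → Qudit r) (e → Qudit r) ℂ) :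
    embedOp e (∑ i ∈ s, a i • A i) = ∑ i ∈ s, a i • embedOp e (A i) := by
  ext x y
  simp only [embedOp, Matrix.sum_apply, Matrix.smul_apply]
  split_ifs <;> simp

open Classical in
/-- The Pauli expansion of a local Hamiltonian. -/
theorem LocalHamiltonian.toMatrix_eq {n k r : ℕ} (H : LocalHamiltonian n k r) :
    H.toMatrix = (1 / (k.factorial : ℂ)) • ∑ c,
      ∑ t ∈ Finset.univ.filter (fun t : Fin k → Fin n => Function.Injective t),
        (H.colorTensor c t : ℂ) • embedOp (tupleSupp t) (pauliLocal c t) := by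
  have hk : (k.factorial : ℂ) ≠ 0 := by exact_mod_cast k.factorial_ne_zero
  have h : ∑ c, ∑ t ∈ Finset.univ.filter (fun t : Fin k → Fin n => Function.Injective t),
      (H.colorTensor c t : ℂ) • embedOp (tupleSupp t) (pauliLocal c t) =
        k.factorial • H.toMatrix := by
    rw [toMatrix, ← sum_tuples_eq H.card_edge, Finset.sum_comm, Finset.sum_filter]
    refine Finset.sum_congr rfl fun t _ => ?_
    split_ifs with h1 h2 h2
    · rw [← embedOp_sum_smul, H.sum_colorTensor_smul h2]
    · simp [colorTensor, h2]
    · exact absurd (H.injective_of_mem h2) h1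
    · rfl
  rw [h, ← Nat.cast_smul_eq_nsmul ℂ, smul_smul, one_div_mul_cancel hk, one_smul]

open Classical in
theorem toMatrix_sub_cutHamiltonian {n k r : ℕ} (H : LocalHamiltonian n k r)
    (D : (Fin k → PauliLabel r) → CutFamily n k) :
    H.toMatrix - cutHamiltonian D = (1 / (k.factorial : ℂ)) • ∑ c,
      ∑ t ∈ Finset.univ.filter (fun t : Fin k → Fin n => Function.Injective t),
        ((D c).remainder (H.colorTensor c) t : ℂ) •
          embedOp (tupleSupp t) (pauliLocal c t) := by
  rw [H.toMatrix_eq, cutHamiltonian, ← smul_sub, ← Finset.sum_sub_distrib]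
  congr 1
  refine Finset.sum_congr rfl fun c _ => ?_
  rw [Finset.sum_comm, ← Finset.sum_sub_distrib]
  refine Finset.sum_congr rfl fun t _ => ?_
  rw [← Finset.sum_smul, ← sub_smul, CutFamily.remainder, CutFamily.toTensor]
  push_cast
  rfl

/-! ### Assembling the bounds. -/

theorem norm_toMatrix_sub_cutHamiltonian_le {n k r : ℕ} (hk : 1 ≤ k)
    {H : LocalHamiltonian n k r} {η : ℝ} (hη : 0 ≤ η)
    {D : (Fin k → PauliLabel r) → CutFamily n k} (hD : IsColoredCutDecomposition H η D) :
    ‖H.toMatrix - cutHamiltonian D‖ ≤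
      Fintype.card (Fin k → PauliLabel r) * (k : ℝ) ^ k * η * (n : ℝ) ^ ((k : ℝ) / 2) *
        H.strengthNorm := by
  have hf : (0 : ℝ) < k.factorial := by exact_mod_cast k.factorial_pos
  set b := (k : ℝ) ^ k * (η * (n : ℝ) ^ ((k : ℝ) / 2) * (k.factorial * H.strengthNorm)) with hb
  rw [toMatrix_sub_cutHamiltonian, norm_smul]
  have h1 := norm_sum_le_of_le (n := fun _ => b) Finset.univ
    fun c (_ : c ∈ Finset.univ) => (norm_sum_injective_pauli_le hk
      ((D c).remainder (H.colorTensor c)) c).trans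
      (mul_le_mul_of_nonneg_left ((hD c).trans (mul_le_mul_of_nonneg_left
        (H.frobNorm_colorTensor_le c) (by positivity))) (by positivity))
  refine (mul_le_mul_of_nonneg_left h1 (norm_nonneg _)).trans_eq ?_
  rw [Finset.sum_const, Finset.card_univ, nsmul_eq_mul, hb]
  simp only [one_div, norm_inv, Complex.norm_natCast]
  field_simp

theorem rpow_half_sq (n k : ℕ) : ((n : ℝ) ^ ((k : ℝ) / 2)) ^ 2 = (n : ℝ) ^ k := by
  rw [← Real.rpow_natCast, ← Real.rpow_mul (Nat.cast_nonneg n)]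
  norm_num

theorem frobNorm_sq {n k : ℕ} (M : Tensor n k) : frobNorm M ^ 2 = ∑ t, M t ^ 2 :=
  Real.sq_sqrt (Finset.sum_nonneg fun _ _ => sq_nonneg _)

/-- The cut decomposition of an array that vanishes on tuples with repetitions, with partite cut
arrays and a coefficient length that does not depend on the accuracy. -/
theorem exists_cut_decomposition {n k : ℕ} (hk : 1 ≤ k) {M : Tensor n k}
    (hM : ∀ t, ¬ Function.Injective t → M t = 0) {η : ℝ} (hη : 0 < η) :
    ∃ D : CutFamily n k,
      inftyOneNorm (D.remainder M) ≤ η * (n : ℝ) ^ ((k : ℝ) / 2) * frobNorm M ∧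
      (D.width : ℝ) ≤ ((k : ℝ) ^ k * 2 ^ k / η) ^ 2 ∧ D.IsPartite ∧
      D.coeffLength ≤ frobNorm M / (n : ℝ) ^ ((k : ℝ) / 2) ∧
      frobNorm (D.remainder M) ≤ frobNorm M := by
  set K : ℝ := (k : ℝ) ^ k * 2 ^ k with hK
  have hK0 : 0 < K := by positivity
  set N : ℝ := (n : ℝ) ^ ((k : ℝ) / 2) with hN
  have hN0 : 0 ≤ N := by positivity
  have hF0 : 0 ≤ frobNorm M := Real.sqrt_nonneg _
  -- In the degenerate case `M` vanishes and the empty family serves; otherwise the threshold `δ`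
  -- below is positive.
  rcases (mul_nonneg hN0 hF0).eq_or_lt with h0 | h0
  · have hM0 : frobNorm M = 0 := by
      rcases mul_eq_zero.1 h0.symm with h | h
      · have hn : (n : ℝ) ^ k = 0 := by rw [← rpow_half_sq, ← hN, h]; norm_num
        have : IsEmpty (Fin k → Fin n) := by
          rw [← Fintype.card_eq_zero_iff]
          simpa using (by exact_mod_cast hn : n ^ k = 0)
        simp [frobNorm]
      · exact h
    have hMz : ∀ t, M t = 0 := by
      have h := frobNorm_sq M
      rw [hM0] at h
      intro t
      have h1 := (Finset.sum_eq_zero_iff_of_nonneg fun t _ => sq_nonneg (M t)).1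
        (h.symm.trans (by norm_num)) t (Finset.mem_univ t)
      exact pow_eq_zero_iff two_ne_zero |>.1 h1
    have hr : (CutFamily.mk 0 Fin.elim0 : CutFamily n k).remainder M = fun _ => 0 := by
      funext t
      simp [CutFamily.remainder, CutFamily.toTensor, hMz]
    refine ⟨⟨0, Fin.elim0⟩, ?_, ?_, fun i => i.elim0, ?_, ?_⟩
    · rw [hr, hM0, mul_zero]
      exact inftyOneNorm_le fun x _ => by simp [multilinearSum]
    · simp only [Nat.cast_zero]
      positivity
    · simp [CutFamily.coeffLength, hM0]
    · simp [hr, frobNorm]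
  · have hNpos : 0 < N := (pos_and_pos_or_neg_and_neg_of_mul_pos h0).elim And.left
      fun h => absurd h.1 (not_lt.2 hN0)
    have hFpos : 0 < frobNorm M := pos_of_mul_pos_right h0 hN0
    -- Passing from disjoint boxes to the `∞ → 1` norm costs the factor `K`, which the division by
    -- `K` absorbs.
    set δ := η / K * (N * frobNorm M) with hδ
    obtain ⟨D, hp, hE, hw, hS⟩ := exists_partite_cutFamily M (by positivity : 0 < δ)
    rw [← frobNorm_sq, ← frobNorm_sq, ← rpow_half_sq, ← hN] at hE
    rw [← frobNorm_sq, ← rpow_half_sq, ← hN] at hw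
    have hW : 0 ≤ ∑ i, (D.cut i).weight ^ 2 := Finset.sum_nonneg fun _ _ => sq_nonneg _
    refine ⟨D, ?_, ?_, hp, ?_, ?_⟩
    · refine (inftyOneNorm_le_of_partite_boxSum hk
        (fun t ht => hp.remainder_eq_zero (hM t ht) ht) hS).trans_eq ?_
      rw [← mul_assoc, ← hK, hδ]
      field_simp
    · rw [hδ] at hw
      have h1 : (D.width : ℝ) * (η / K) ^ 2 ≤ 1 := by
        refine le_of_mul_le_mul_right ?_ (by positivity : 0 < (N * frobNorm M) ^ 2)
        calc (D.width : ℝ) * (η / K) ^ 2 * (N * frobNorm M) ^ 2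
            = D.width * (η / K * (N * frobNorm M)) ^ 2 := by ring
          _ ≤ N ^ 2 * frobNorm M ^ 2 := hw
          _ = 1 * (N * frobNorm M) ^ 2 := by ring
      rw [← le_div_iff₀ (by positivity)] at h1
      refine h1.trans_eq ?_
      rw [one_div, ← inv_pow, inv_div]
    · refine Real.sqrt_le_iff.2 ⟨by positivity, ?_⟩
      rw [div_pow, le_div_iff₀ (by positivity), mul_comm]
      linarith [sq_nonneg (frobNorm (D.remainder M))]
    · refine abs_le_of_sq_le_sq' ?_ hF0 |>.2
      have : 0 ≤ N ^ 2 * ∑ i, (D.cut i).weight ^ 2 := by positivity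
      linarith

theorem LocalHamiltonian.strengthNorm_le {n k r : ℕ} (H : LocalHamiltonian n k r)
    (h : ∀ e ∈ H.edges, matrixSpectralNorm (H.term e) ≤ 1) :
    H.strengthNorm ≤ (H.edges.card : ℝ) ^ (1 / 2 : ℝ) := by
  rw [← Real.sqrt_eq_rpow]
  refine Real.sqrt_le_sqrt ?_
  have := Finset.sum_le_card_nsmul H.edges (fun e => matrixSpectralNorm (H.term e) ^ 2) 1
    fun e he => pow_le_one₀ (norm_nonneg _) (h e he)
  simpa using this

theorem mainTheorem4 (k r : ℕ) (hk : 1 ≤ k) :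
    ∃ A B : ℝ, 0 < A ∧ 0 < B ∧
      ∀ (ε : ℝ), 0 < ε → ∀ (n : ℕ) (H : LocalHamiltonian n k r),
        (∃ D : (Fin k → PauliLabel r) → CutFamily n k,
          IsColoredCutDecomposition H (ε / A) D ∧
          ∀ c, ((D c).width : ℝ) ≤ B / ε ^ 2 ∧
            (D c).IsPartite ∧
            (D c).coeffLength ≤ B * frobNorm (H.colorTensor c) / (n : ℝ) ^ ((k : ℝ) / 2) ∧
            frobNorm ((D c).remainder (H.colorTensor c)) ≤ frobNorm (H.colorTensor c)) ∧
        (∀ D : (Fin k → PauliLabel r) → CutFamily n k,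
          IsColoredCutDecomposition H (ε / A) D →
          (∀ ρ : Fin n → Matrix (Qudit r) (Qudit r) ℂ, (∀ u, IsDensity (ρ u)) →
            ‖((H.toMatrix - cutHamiltonian D) * tensorOp ρ).trace‖ ≤
              ε * (n : ℝ) ^ ((k : ℝ) / 2) * H.strengthNorm) ∧
          matrixSpectralNorm (H.toMatrix - cutHamiltonian D) ≤
            ε * (n : ℝ) ^ ((k : ℝ) / 2) * H.strengthNorm ∧
          ((∀ e ∈ H.edges, matrixSpectralNorm (H.term e) ≤ 1) →
            (∀ ρ : Fin n → Matrix (Qudit r) (Qudit r) ℂ, (∀ u, IsDensity (ρ u)) →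
              ‖((H.toMatrix - cutHamiltonian D) * tensorOp ρ).trace‖ ≤
                ε * (n : ℝ) ^ ((k : ℝ) / 2) * (H.edges.card : ℝ) ^ (1 / 2 : ℝ)) ∧
            matrixSpectralNorm (H.toMatrix - cutHamiltonian D) ≤
              ε * (n : ℝ) ^ ((k : ℝ) / 2) * (H.edges.card : ℝ) ^ (1 / 2 : ℝ))) := by
  set A : ℝ := Fintype.card (Fin k → PauliLabel r) * (k : ℝ) ^ k with hA
  have hA0 : 0 < A := mul_pos (Nat.cast_pos.2 Fintype.card_pos) (by positivity)
  -- The square is the width constant at accuracy `ε / A`; the added `1` makes `B ≥ 1` for the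
  -- coefficient bound.
  refine ⟨A, ((k : ℝ) ^ k * 2 ^ k * A) ^ 2 + 1, hA0, by positivity, fun ε hε n H => ⟨?_, ?_⟩⟩
  · have hη : 0 < ε / A := by positivity
    choose D h1 h2 h3 h4 h5 using fun c =>
      exists_cut_decomposition hk (fun t ht => H.colorTensor_eq_zero c ht) hη
    refine ⟨D, h1, fun c => ⟨(h2 c).trans ?_, h3 c, (h4 c).trans ?_, h5 c⟩⟩
    · rw [div_div_eq_mul_div, div_pow]
      gcongr
      linarith
    · gcongr
      exact le_mul_of_one_le_left (Real.sqrt_nonneg _)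
        (by linarith [sq_nonneg ((k : ℝ) ^ k * 2 ^ k * A)])
  · intro D hD
    have h1 : ‖H.toMatrix - cutHamiltonian D‖ ≤
        ε * (n : ℝ) ^ ((k : ℝ) / 2) * H.strengthNorm := by
      refine (norm_toMatrix_sub_cutHamiltonian_le hk (by positivity) hD).trans_eq ?_
      rw [← hA, mul_div_cancel₀ _ hA0.ne']
    refine ⟨fun ρ hρ => (norm_trace_mul_tensorOp_le _ hρ).trans h1, h1, fun hJ => ?_⟩
    have h2 : ‖H.toMatrix - cutHamiltonian D‖ ≤
        ε * (n : ℝ) ^ ((k : ℝ) / 2) * (H.edges.card : ℝ) ^ (1 / 2 : ℝ) :=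
      h1.trans (mul_le_mul_of_nonneg_left (H.strengthNorm_le hJ) (by positivity))
    exact ⟨fun ρ hρ => (norm_trace_mul_tensorOp_le _ hρ).trans h2, h2⟩

end
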